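/- A morphism $\tau\colon B\to B^*$ on a finite alphabet $B$ is called a *substitution* if $\lim_{n\to\infty}|\tau^n(b)|=+\infty$ for every letter $b\in B$. Its matrix is $M_\tau=(m_{i,j})_{i,j\in B}$, where $m_{i,j}$ is the number of occurrences of $i$ in $\tau(j)$; $\tau$ is *primitive* if some positive power of $M_\tau$ has only positive entries. A *dominant eigenvalue* of $\tau$ is an eigenvalue $r$ of $M_\tau$ such that $|\mu|\le|r|$ for every other complex eigenvalue $\mu$ of $M_\tau$. A fixed point of $\tau$ is a sequence $y\in B^{\mathbb N}$ with $\tau(y)=y$; it is *proper* if every letter of $B$ occurs in $y$. A sequence $x\in A^{\mathbb N}$ is *$\alpha$-substitutive* (resp. *$\alpha$-substitutive primitive*) if there are a finite alphabet $B$, a substitution (resp. a primitive substitution) $\tau$ on $B$ with dominant eigenvalue $\alpha$, a proper fixed point $y$ of $\tau$, and a map $\phi\colon B\to A$ such that $x_n=\phi(y_n)$ for all $n\in\mathbb N$. The sequence $x$ is *ultimately periodic* if $x=uv^\omega=uvvv\cdots$ for some word $u$ and some non-empty word $v$, and *periodic* if one can take $u$ empty. **Proposition.** Let $A$ be a finite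 alphabet, let $x\in A^{\mathbb N}$, and let $\alpha>1$ be a Perron number, that is, a real algebraic integer such that $|z|<\alpha$ for every algebraic conjugate $z\ne\alpha$ of $\alpha$. If $x$ is periodic, then $x$ is $\alpha$-substitutive primitive. If $x$ is ultimately periodic, then $x$ is $\alpha$-substitutive. -/

import Mathlib

open Filter

/-- The map `A* → B*` induced by a morphism `τ : A → B*`, by concatenation. -/
def wordMap {A B : Type*} (τ : A → List B) (w : List A) : List B :=
  w.flatMap τ

/-- The prefix `x₀ x₁ ⋯ x_{n-1}` of length `n` of a sequence. -/
def seqPrefix {A : Type*} (x : ℕ → A) (n : ℕ) : List A :=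
  List.ofFn fun i : Fin n => x i

theorem length_wordMap_ge {A B : Type*} (τ : A → List B) (hτ : ∀ a, τ a ≠ []) (w : List A) :
    w.length ≤ (wordMap τ w).length := by
  induction w with
  | nil => simp
  | cons a w ih =>
    have h := List.length_pos_iff.mpr (hτ a)
    simp only [wordMap, List.flatMap_cons, List.length_append, List.length_cons] at ih ⊢
    omega

/-- The map `A^ℕ → B^ℕ` induced by a morphism `τ : A → B⁺`: the sequence
`τ(x₀) τ(x₁) τ(x₂) ⋯`.  Its `k`-th letter is already the `k`-th letter of the word
`τ(x₀ ⋯ x_k)`, whose length is at least `k + 1` and which is a prefix of the sequence. -/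
def seqMap {A B : Type*} (τ : A → List B) (hτ : ∀ a, τ a ≠ []) (x : ℕ → A) : ℕ → B :=
  fun k => (wordMap τ (seqPrefix x (k + 1)))[k]'(by
    have h := length_wordMap_ge τ hτ (seqPrefix x (k + 1))
    simp only [seqPrefix, List.length_ofFn] at h ⊢
    omega)

/-- The sequence `v^ω = v v v ⋯` for a non-empty word `v`. -/
def omegaPow {A : Type*} (v : List A) (hv : v ≠ []) : ℕ → A :=
  fun n => v[n % v.length]'(Nat.mod_lt n (List.length_pos_iff.mpr hv))

/-- The sequence `u y`, for a word `u` and a sequence `y`. -/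
def wordAppendSeq {A : Type*} (u : List A) (y : ℕ → A) : ℕ → A :=
  fun n => if h : n < u.length then u[n] else y (n - u.length)

/-- `x = v^ω` for some non-empty word `v`. -/
def IsPeriodicSeq {A : Type*} (x : ℕ → A) : Prop :=
  ∃ (v : List A) (hv : v ≠ []), x = omegaPow v hv

/-- `x = u v^ω` for some word `u` and some non-empty word `v`. -/
def IsUltimatelyPeriodicSeq {A : Type*} (x : ℕ → A) : Prop :=
  ∃ (u v : List A) (hv : v ≠ []), x = wordAppendSeq u (omegaPow v hv)

/-- A substitution: a morphism `τ : A → A*` with `|τⁿ(a)| → ∞` for every letter `a`. -/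
structure Substitution (A : Type*) where
  /-- the image of a letter -/
  toFun : A → List A
  /-- the iterated images of each letter grow without bound -/
  growing : ∀ a, Tendsto (fun n : ℕ => ((wordMap toFun)^[n] [a]).length) atTop atTop

namespace Substitution

variable {A : Type*}

theorem toFun_ne_nil (τ : Substitution A) (a : A) : τ.toFun a ≠ [] := by
  intro h
  have hfix : ∀ n : ℕ, (wordMap τ.toFun)^[n + 1] [a] = [] := by
    intro n
    rw [Function.iterate_succ_apply]
    have h1 : wordMap τ.toFun [a] = [] := by simp [wordMap, h]
    rw [h1]
    exact Function.iterate_fixed (by simp [wordMap]) n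
  obtain ⟨N, hN⟩ := (tendsto_atTop_atTop.mp (τ.growing a)) 1
  have h2 := hN (N + 1) (Nat.le_succ N)
  rw [hfix N] at h2
  simp at h2

/-- `τ(x) = x`. -/
def IsFixedPoint (τ : Substitution A) (x : ℕ → A) : Prop :=
  seqMap τ.toFun τ.toFun_ne_nil x = x

/-- A fixed point in which all letters of the alphabet occur. -/
def IsProperFixedPoint (τ : Substitution A) (x : ℕ → A) : Prop :=
  τ.IsFixedPoint x ∧ ∀ a, ∃ n, x n = a

open Classical in
/-- The matrix `M_τ`: its entry `(i, j)` is the number of occurrences of `i` in `τ(j)`. -/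
noncomputable def incidenceMatrix (τ : Substitution A) (R : Type*) [NatCast R] : Matrix A A R :=
  Matrix.of fun i j => ((τ.toFun j).count i : R)

end Substitution

/-- `r` is a dominant eigenvalue of the complex square matrix `M`: an eigenvalue whose modulus is
at least the modulus of every other eigenvalue. -/
def IsDominantEigenvalue {A : Type*} [Fintype A] (M : Matrix A A ℂ) (r : ℂ) : Prop :=
  Module.End.HasEigenvalue M.mulVecLin r ∧
    ∀ μ : ℂ, Module.End.HasEigenvalue M.mulVecLin μ → μ ≠ r → ‖μ‖ ≤ ‖r‖

open Classical in
/-- A primitive substitution: its matrix is primitive. -/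
def Substitution.IsPrimitive {A : Type*} [Fintype A] (τ : Substitution A) : Prop :=
  (τ.incidenceMatrix ℤ).IsPrimitive

/-- `x` is `θ`-substitutive in the class `S` of substitutions: it is the image under a
letter to letter morphism `φ` of a proper fixed point of a substitution in `S` whose dominant
eigenvalue is `θ`. -/
def IsSubstitutiveIn (S : ∀ (B : Type) [Fintype B], Substitution B → Prop) (θ : ℝ)
    {A : Type*} (x : ℕ → A) : Prop :=
  ∃ (B : Type) (_ : Fintype B) (τ : Substitution B) (y : ℕ → B) (φ : B → A),
    S B τ ∧ τ.IsProperFixedPoint y ∧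
      IsDominantEigenvalue (τ.incidenceMatrix ℂ) (θ : ℂ) ∧ x = fun n => φ (y n)

/-- `θ`-substitutive: all substitutions are allowed. -/
def IsSubstitutive (θ : ℝ) {A : Type*} (x : ℕ → A) : Prop :=
  IsSubstitutiveIn (fun _ _ _ => True) θ x

/-- `θ`-substitutive primitive: only primitive substitutions are allowed. -/
def IsSubstitutivePrimitive (θ : ℝ) {A : Type*} (x : ℕ → A) : Prop :=
  IsSubstitutiveIn (fun _ _ τ => τ.IsPrimitive) θ x

/-- A real algebraic integer that strictly dominates in modulus all its other conjugates, i.e. the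
other complex roots of its minimal polynomial over `ℚ`. -/
def IsPerronNumber (α : ℝ) : Prop :=
  IsIntegral ℤ α ∧ ∀ z : ℂ, z ∈ (minpoly ℚ α).aroots ℂ → z ≠ (α : ℂ) → ‖z‖ < α

/-! A positive weight `w` on letters with `w(τ(a)) = α w(a)` is a left eigenvector of the matrix. It
makes α a dominant eigenvalue (`isDominantEigenvalue_of_weight`) and forces growth. Weights come
from the ring of integers of ℚ(α) (`exists_perronLattice`): letters are integers `a` whose real
value is positive, bounded, and at least the sum of the moduli of `a` under the other embeddings.
There are finitely many of these.

By `exists_decomposition`, each product `αa` is a sum of such letters. While `αa` is small, `a` maps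
to the single letter `αa`; otherwise `a` maps to a fixed letter `b` followed by a balanced splitting
of `αa - b` into `p` letters. All images then have length 1 modulo `p`. The Perron condition keeps
the pieces in the cone, and `p > α` keeps them bounded.

Attach to each letter a label modulo `p` and number each image consecutively from the label of its
source. Since lengths are 1 modulo `p`, the fixed point starting at `(b, 0)` carries label `n` at
position `n`; every `p`-periodic sequence is thus a letter-to-letter image of it
(`exists_labelled_substitution`). First letters eventually reach `b`, and `b` reaches itself with
the next label, which gives primitivity.

For a preperiod of length `m`, the first `m` positions of the fixed point become new letters
(`Substitution.marked`). Forgetting the marks pulls the weight back, so α stays dominant. -/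

/-- An abelian group with a positive-cone structure adapted to a number `α`: a real functional
`val` and a complementary seminorm `N`, an operator `T` multiplying `val` by `α` and contracting
`N` relative to `α`, finiteness of bounded sets, and balanced division into `p` parts. -/
structure PerronLattice (α : ℝ) where
  /-- the underlying type -/
  R : Type
  [grp : AddCommGroup R]
  /-- the dominant coordinate -/
  val : R →+ ℝ
  /-- the size of the remaining coordinates -/
  N : R → ℝ
  /-- multiplication by `α` -/
  T : R → R
  /-- a bound for the expansion of `N` under `T` -/
  ρ : ℝ
  /-- the error in balanced divisions -/
  D : ℝ
  /-- a positive element -/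
  e : R
  ρ_nonneg : 0 ≤ ρ
  ρ_lt : ρ < α
  D_pos : 0 < D
  N_nonneg : ∀ a, 0 ≤ N a
  N_sub_le : ∀ a b, N (a - b) ≤ N a + N b
  N_T_le : ∀ a, N (T a) ≤ ρ * N a
  val_T : ∀ a, val (T a) = α * val a
  val_e_pos : 0 < val e
  finite_bounded : ∀ Y : ℝ, {a | |val a| ≤ Y ∧ N a ≤ Y}.Finite
  exists_split : ∀ p : ℕ, 0 < p → ∀ a, ∃ g : Fin p → R, ∑ j, g j = a ∧
    ∀ j, |val (g j) - val a / p| ≤ D ∧ N (g j) ≤ N a / p + D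

attribute [instance] PerronLattice.grp

/-- Hermite's identity: replacing `a` by `a + 1` shifts the window of `p` terms by one, which trades
the first term for itself plus 1. -/
theorem Int.sum_range_add_ediv (p : ℕ) (hp : 0 < p) (a : ℤ) :
    ∑ j ∈ Finset.range p, (a + j) / (p : ℤ) = a := by
  have hp' : (p : ℤ) ≠ 0 := by positivity
  have step : ∀ a : ℤ, ∑ j ∈ Finset.range p, (a + 1 + j) / (p : ℤ) =
      ∑ j ∈ Finset.range p, (a + j) / (p : ℤ) + 1 := by
    intro a
    have h1 := Finset.sum_range_succ (fun j : ℕ => (a + j) / (p : ℤ)) p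
    have h2 := Finset.sum_range_succ' (fun j : ℕ => (a + j) / (p : ℤ)) p
    have h3 : (a + (p : ℤ)) / p = a / p + 1 := by
      rw [Int.add_ediv_of_dvd_right (dvd_refl _), Int.ediv_self hp']
    have h4 : ∑ j ∈ Finset.range p, (a + 1 + j) / (p : ℤ) =
        ∑ j ∈ Finset.range p, (a + ((j + 1 : ℕ) : ℤ)) / (p : ℤ) :=
      Finset.sum_congr rfl fun j _ => by push_cast; ring_nf
    rw [h1, h3] at h2
    simp only [Nat.cast_zero, add_zero] at h2
    rw [h4]
    linarith
  have zero : ∑ j ∈ Finset.range p, ((0 : ℤ) + j) / (p : ℤ) = 0 :=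
    Finset.sum_eq_zero fun j hj => by
      rw [zero_add]
      exact Int.ediv_eq_zero_of_lt (by positivity) (by exact_mod_cast Finset.mem_range.mp hj)
  induction a using Int.induction_on with
  | zero => exact zero
  | succ n ih => rw [step, ih]
  | pred n ih =>
    have h := step (-(n : ℤ) - 1)
    rw [sub_add_cancel, ih] at h
    linarith

theorem Int.abs_ediv_sub_div_le_one (p : ℕ) (a : ℤ) (j : ℕ) (hj : j < p) :
    |(((a + j) / (p : ℤ) : ℤ) : ℝ) - (a : ℝ) / p| ≤ 1 := by
  have hp : (0 : ℝ) < p := by exact_mod_cast (Nat.zero_le j).trans_lt hj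
  have hpz : (0 : ℤ) < p := by exact_mod_cast hp
  have h1 := Int.ediv_mul_le (a + j) hpz.ne'
  have h2 := Int.lt_ediv_add_one_mul_self (a + j) hpz
  have h1' : (((a + j) / (p : ℤ) : ℤ) : ℝ) * p ≤ a + j := by exact_mod_cast h1
  have h2' : (a : ℝ) + j < ((((a + j) / (p : ℤ) : ℤ) : ℝ) + 1) * p := by exact_mod_cast h2
  have hj' : (j : ℝ) < p := by exact_mod_cast hj
  have hj0 : (0 : ℝ) ≤ j := by positivity
  have ha : (a : ℝ) / p * p = a := by field_simp
  rw [abs_le]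
  constructor <;> nlinarith

/-! ### The ring of integers of ℚ(α) and its embeddings -/

section NumberField

open NumberField

/-- Every Perron number is the dominant coordinate of some lattice: the ring of integers of the
field it generates. -/
theorem exists_perronLattice (α : ℝ) (hα : IsPerronNumber α) (hα1 : 1 < α) :
    Nonempty (PerronLattice α) := by
  classical
  obtain ⟨hint, hdom⟩ := hα
  have hintQ : IsIntegral ℚ α := hint.tower_top
  let K := IntermediateField.adjoin ℚ {α}
  have : FiniteDimensional ℚ K := IntermediateField.adjoin.finiteDimensional hintQ
  have : NumberField K := { }
  let θK : K := IntermediateField.AdjoinSimple.gen ℚ α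
  have hθα : ((θK : K) : ℝ) = α := IntermediateField.AdjoinSimple.coe_gen ℚ α
  have hθint : IsIntegral ℤ θK := by
    have : IsIntegral ℤ (algebraMap K ℝ θK) := by
      have h : algebraMap K ℝ θK = α := hθα
      rw [h]; exact hint
    exact (isIntegral_algebraMap_iff (algebraMap K ℝ).injective).mp this
  let θ : 𝓞 K := ⟨θK, hθint⟩
  let v : K →+* ℝ := algebraMap K ℝ
  have hvθ : v θK = α := hθα
  let σ₀ : K →+* ℂ := (algebraMap ℝ ℂ).comp v
  have hσ₀ : ∀ x, σ₀ x = ((v x : ℝ) : ℂ) := fun _ => rfl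
  have hconj : ∀ σ : K →+* ℂ, σ ≠ σ₀ → ‖σ θK‖ < α := by
    intro σ hσ
    apply hdom
    · rw [Polynomial.mem_aroots]
      refine ⟨minpoly.ne_zero hintQ, ?_⟩
      have h1 : minpoly ℚ α = minpoly ℚ θK :=
        (IntermediateField.minpoly_gen ℚ α).symm
      rw [h1]
      have h2 := Polynomial.aeval_algHom_apply (σ.toRatAlgHom) θK (minpoly ℚ θK)
      rw [minpoly.aeval, map_zero] at h2
      exact h2
    · intro h
      apply hσ
      have : σ.toRatAlgHom = σ₀.toRatAlgHom := by
        apply (IntermediateField.adjoin.powerBasis hintQ).algHom_ext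
        rw [IntermediateField.adjoin.powerBasis_gen]
        change σ θK = σ₀ θK
        rw [h, hσ₀, hvθ]
      ext x
      exact congrArg (fun f : K →ₐ[ℚ] ℂ => f x) this
  let s : Finset (K →+* ℂ) := Finset.univ.filter (· ≠ σ₀)
  -- A maximum over the other embeddings, built by induction because there are none when α is
  -- rational.
  obtain ⟨ρ, hρ0, hρα, hρ⟩ : ∃ ρ : ℝ, 0 ≤ ρ ∧ ρ < α ∧ ∀ σ ∈ s, ‖σ θK‖ ≤ ρ := by
    have hs : ∀ σ ∈ s, ‖σ θK‖ < α := fun σ h => hconj σ (Finset.mem_filter.mp h).2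
    clear_value s
    induction s using Finset.induction_on with
    | empty => exact ⟨0, le_rfl, by linarith, by simp⟩
    | insert σ t _ ih =>
      obtain ⟨r, h0, h1, h2⟩ := ih fun τ hτ => hs τ (Finset.mem_insert_of_mem hτ)
      refine ⟨max r ‖σ θK‖, le_max_of_le_left h0,
        max_lt h1 (hs σ (Finset.mem_insert_self _ _)), ?_⟩
      intro τ hτ
      rcases Finset.mem_insert.mp hτ with rfl | h
      · exact le_max_right _ _
      · exact (h2 τ h).trans (le_max_left _ _)
  let val : 𝓞 K →+ ℝ := (v.comp (algebraMap (𝓞 K) K)).toAddMonoidHom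
  have hval : ∀ a : 𝓞 K, val a = v (a : K) := fun _ => rfl
  let N : 𝓞 K → ℝ := fun a => ∑ σ ∈ s, ‖σ (a : K)‖
  let ω := RingOfIntegers.basis K
  -- Rounding each integral coordinate costs at most 1, hence this sum over all embeddings; the
  -- extra 1 makes `D` visibly positive.
  let D : ℝ := 1 + ∑ σ : K →+* ℂ, ∑ i, ‖σ (ω i : K)‖
  have hDσ : ∀ (p : ℕ) (j : ℕ), j < p → ∀ (a : 𝓞 K) (σ : K →+* ℂ),
      ‖σ ((∑ i, ((ω.repr a i + j) / (p : ℤ)) • ω i : 𝓞 K) : K) - σ (a : K) / p‖ ≤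
        ∑ i, ‖σ (ω i : K)‖ := by
    intro p j hj a σ
    have ha : σ (a : K) = ∑ i, (ω.repr a i : ℂ) * σ (ω i : K) := by
      conv_lhs => rw [← ω.sum_repr a]
      simp
    rw [ha, Finset.sum_div]
    have hg : σ ((∑ i, ((ω.repr a i + j) / (p : ℤ)) • ω i : 𝓞 K) : K) =
        ∑ i, (((ω.repr a i + j) / (p : ℤ) : ℤ) : ℂ) * σ (ω i : K) := by
      simp
    rw [hg, ← Finset.sum_sub_distrib]
    refine (norm_sum_le _ _).trans (Finset.sum_le_sum fun i _ => ?_)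
    have h1 : (((ω.repr a i + j) / (p : ℤ) : ℤ) : ℂ) * σ (ω i : K) -
        (ω.repr a i : ℂ) * σ (ω i : K) / p =
        (((((ω.repr a i + j) / (p : ℤ) : ℤ) : ℝ) - (ω.repr a i : ℝ) / p : ℝ) : ℂ) *
          σ (ω i : K) := by
      push_cast; ring
    rw [h1, norm_mul, Complex.norm_real, Real.norm_eq_abs]
    exact mul_le_of_le_one_left (norm_nonneg _)
      (Int.abs_ediv_sub_div_le_one p (ω.repr a i) j hj)
  have hDpos : 0 < D := by positivity
  refine ⟨{ R := 𝓞 K, val := val, N := N, T := fun a => θ * a, ρ := ρ, D := D, e := 1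
            ρ_nonneg := hρ0, ρ_lt := hρα, D_pos := hDpos, N_nonneg := ?_, N_sub_le := ?_
            N_T_le := ?_, val_T := ?_, val_e_pos := ?_, finite_bounded := ?_
            exists_split := ?_ }⟩
  · intro a; positivity
  · intro a b
    change ∑ σ ∈ s, ‖σ ((a - b : 𝓞 K) : K)‖ ≤ _
    rw [← Finset.sum_add_distrib]
    refine Finset.sum_le_sum fun σ _ => ?_
    simpa using norm_sub_le (σ (a : K)) (σ (b : K))
  · intro a
    change ∑ σ ∈ s, ‖σ ((θ * a : 𝓞 K) : K)‖ ≤ _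
    rw [Finset.mul_sum]
    refine Finset.sum_le_sum fun σ hσ => ?_
    have : σ ((θ * a : 𝓞 K) : K) = σ θK * σ (a : K) :=
      map_mul (σ.comp (algebraMap (𝓞 K) K)) θ a
    rw [this, norm_mul]
    exact mul_le_mul_of_nonneg_right (hρ σ hσ) (norm_nonneg _)
  · intro a
    have : v ((θ * a : 𝓞 K) : K) = v θK * v (a : K) :=
      map_mul (v.comp (algebraMap (𝓞 K) K)) θ a
    rw [hval, hval, this, hvθ]
  · rw [hval]; simp
  · intro Y
    refine Set.Finite.subset ((NumberField.Embeddings.finite_of_norm_le K ℂ Y).preimage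
      (f := fun a : 𝓞 K => (a : K)) RingOfIntegers.coe_injective.injOn) ?_
    rintro a ⟨h1, h2⟩
    refine ⟨a.isIntegral_coe, fun σ => ?_⟩
    by_cases hσ : σ = σ₀
    · rw [hσ, hσ₀, Complex.norm_real]; exact h1
    · exact (Finset.single_le_sum (f := fun σ : K →+* ℂ => ‖σ (a : K)‖)
        (fun _ _ => norm_nonneg _) (Finset.mem_filter.mpr ⟨Finset.mem_univ σ, hσ⟩)).trans h2
  · intro p hp a
    refine ⟨fun j => ∑ i, ((ω.repr a i + (j : ℕ)) / (p : ℤ)) • ω i, ?_, fun j => ⟨?_, ?_⟩⟩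
    · rw [Finset.sum_comm]
      conv_rhs => rw [← ω.sum_repr a]
      refine Finset.sum_congr rfl fun i _ => ?_
      rw [← Finset.sum_smul, Fin.sum_univ_eq_sum_range
        (fun j : ℕ => (ω.repr a i + (j : ℤ)) / (p : ℤ)), Int.sum_range_add_ediv p hp]
    · have h := hDσ p j j.2 a σ₀
      rw [hσ₀, hσ₀] at h
      have h' : ∀ x y : ℝ, ‖(x : ℂ) - (y : ℂ) / p‖ = |x - y / p| := by
        intro x y
        rw [← Real.norm_eq_abs, ← Complex.norm_real]
        push_cast; rfl
      rw [h'] at h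
      refine h.trans ?_
      have := Finset.single_le_sum (f := fun σ : K →+* ℂ => ∑ i, ‖σ (ω i : K)‖)
        (fun _ _ => by positivity) (Finset.mem_univ σ₀)
      change _ ≤ 1 + _
      linarith
    · have h1 : ∀ σ : K →+* ℂ,
          ‖σ ((∑ i, ((ω.repr a i + (j : ℕ)) / (p : ℤ)) • ω i : 𝓞 K) : K)‖ ≤
          ‖σ (a : K)‖ / p + ∑ i, ‖σ (ω i : K)‖ := by
        intro σ
        have h := hDσ p j j.2 a σ
        have h2 := norm_sub_norm_le
          (σ ((∑ i, ((ω.repr a i + (j : ℕ)) / (p : ℤ)) • ω i : 𝓞 K) : K)) (σ (a : K) / p)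
        rw [norm_div, Complex.norm_natCast] at h2
        linarith
      refine (Finset.sum_le_sum fun σ _ => h1 σ).trans ?_
      rw [Finset.sum_add_distrib, ← Finset.sum_div]
      have h3 : ∑ σ ∈ s, ∑ i, ‖σ (ω i : K)‖ ≤ ∑ σ : K →+* ℂ, ∑ i, ‖σ (ω i : K)‖ :=
        Finset.sum_le_sum_of_subset_of_nonneg (Finset.subset_univ _)
          fun _ _ _ => by positivity
      change _ ≤ N a / p + (1 + _)
      linarith

end NumberField

/-! ### Decomposing multiplication by α inside a finite cone -/

namespace PerronLattice

variable {α : ℝ} (Λ : PerronLattice α)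

/-- High iterates of `T` on `e` work: `val` grows like `α ^ k` while `N` grows at most like `ρ ^ k`,
and both `ρ / α` and `1 / α` are below 1. -/
theorem exists_deep_element (hα1 : 1 < α) (C E : ℝ) (hC : 0 ≤ C) :
    ∃ b : Λ.R, 0 < Λ.val b ∧ C * Λ.N b + E ≤ (α - 1) * Λ.val b ∧ Λ.N b ≤ Λ.val b := by
  have hα0 : 0 < α := by linarith
  have hiter : ∀ k : ℕ, Λ.val (Λ.T^[k] Λ.e) = α ^ k * Λ.val Λ.e ∧
      Λ.N (Λ.T^[k] Λ.e) ≤ Λ.ρ ^ k * Λ.N Λ.e := by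
    intro k
    induction k with
    | zero => simp
    | succ k ih =>
      rw [Function.iterate_succ_apply']
      constructor
      · rw [Λ.val_T, ih.1]; ring
      · refine (Λ.N_T_le _).trans ((mul_le_mul_of_nonneg_left ih.2 Λ.ρ_nonneg).trans_eq ?_)
        ring
  have hr : Tendsto (fun k : ℕ => (Λ.ρ / α) ^ k) atTop (nhds 0) :=
    tendsto_pow_atTop_nhds_zero_of_lt_one (div_nonneg Λ.ρ_nonneg hα0.le)
      ((div_lt_one hα0).mpr Λ.ρ_lt)
  have hinv : Tendsto (fun k : ℕ => (1 / α) ^ k) atTop (nhds 0) :=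
    tendsto_pow_atTop_nhds_zero_of_lt_one (by positivity) ((div_lt_one hα0).mpr hα1)
  have h1 : Tendsto (fun k : ℕ => C * Λ.N Λ.e * (Λ.ρ / α) ^ k + E * (1 / α) ^ k)
      atTop (nhds 0) := by
    simpa using (hr.const_mul (C * Λ.N Λ.e)).add (hinv.const_mul E)
  have h2 : Tendsto (fun k : ℕ => Λ.N Λ.e * (Λ.ρ / α) ^ k) atTop (nhds 0) := by
    simpa using hr.const_mul (Λ.N Λ.e)
  have hpos : 0 < (α - 1) * Λ.val Λ.e := mul_pos (by linarith) Λ.val_e_pos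
  obtain ⟨k, hk1, hk2⟩ := ((h1.eventually (gt_mem_nhds hpos)).and
    (h2.eventually (gt_mem_nhds Λ.val_e_pos))).exists
  have hαk : 0 < α ^ k := by positivity
  refine ⟨Λ.T^[k] Λ.e, ?_, ?_, ?_⟩
  · rw [(hiter k).1]; exact mul_pos hαk Λ.val_e_pos
  · rw [(hiter k).1]
    have h3 : C * Λ.N (Λ.T^[k] Λ.e) ≤ C * (Λ.ρ ^ k * Λ.N Λ.e) :=
      mul_le_mul_of_nonneg_left (hiter k).2 hC
    have h4 := mul_le_mul_of_nonneg_left hk1.le hαk.le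
    have h5 : α ^ k * (C * Λ.N Λ.e * (Λ.ρ / α) ^ k + E * (1 / α) ^ k) =
        C * (Λ.ρ ^ k * Λ.N Λ.e) + E := by
      rw [div_pow, div_pow, one_pow]; field_simp
    rw [h5] at h4
    linarith
  · rw [(hiter k).1]
    have h4 := mul_le_mul_of_nonneg_left hk2.le hαk.le
    have h5 : α ^ k * (Λ.N Λ.e * (Λ.ρ / α) ^ k) = Λ.ρ ^ k * Λ.N Λ.e := by
      rw [div_pow]; field_simp
    rw [h5] at h4
    exact (hiter k).2.trans h4

/-- The cone of elements whose dominant coordinate is positive, dominates the others, and is at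
most `Y`. -/
def cone (Y : ℝ) : Set Λ.R := {a | 0 < Λ.val a ∧ Λ.val a ≤ Y ∧ Λ.N a ≤ Λ.val a}

theorem cone_finite (Y : ℝ) : (Λ.cone Y).Finite :=
  (Λ.finite_bounded Y).subset fun _ ⟨h1, h2, h3⟩ =>
    ⟨by rwa [abs_of_pos h1], h3.trans h2⟩

/-- Each of the `p` balanced pieces loses at most `D` in `val` and gains at most `D` in `N`, so a
margin of `2 * p * D` before splitting suffices. -/
theorem exists_split_in_cone (p : ℕ) (hp : 0 < p) (Y : ℝ) (c : Λ.R)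
    (h1 : Λ.N c + 2 * p * Λ.D ≤ Λ.val c) (h2 : Λ.val c + p * Λ.D ≤ p * Y) :
    ∃ w : List Λ.R, w.length = p ∧ w.sum = c ∧ ∀ g ∈ w, g ∈ Λ.cone Y := by
  obtain ⟨g, hg, hb⟩ := Λ.exists_split p hp c
  have hp' : (0 : ℝ) < p := by exact_mod_cast hp
  refine ⟨List.ofFn g, by simp, by rw [List.sum_ofFn, hg], ?_⟩
  intro x hx
  obtain ⟨j, rfl⟩ := (List.mem_ofFn' g x).mp hx
  obtain ⟨hv, hN⟩ := hb j
  have h1' : Λ.N c / p + 2 * Λ.D ≤ Λ.val c / p := by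
    rw [← sub_nonneg]
    have : Λ.val c / p - (Λ.N c / p + 2 * Λ.D) = (Λ.val c - (Λ.N c + 2 * p * Λ.D)) / p := by
      field_simp
    rw [this]
    exact div_nonneg (by linarith) hp'.le
  have h2' : Λ.val c / p + Λ.D ≤ Y := by
    rw [← sub_nonneg]
    have : Y - (Λ.val c / p + Λ.D) = (p * Y - (Λ.val c + p * Λ.D)) / p := by
      field_simp
    rw [this]
    exact div_nonneg (by linarith) hp'.le
  have hN0 : 0 ≤ Λ.N c / p := div_nonneg (Λ.N_nonneg c) hp'.le
  have hD := Λ.D_pos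
  rw [abs_le] at hv
  exact ⟨by linarith, by linarith, by linarith⟩

/-- A finite subset of the lattice carrying a morphism `a ↦ h a · t a` whose images sum to `T a`,
have length congruent to `1` modulo `p`, and whose first letters lead to a common letter. -/
theorem exists_decomposition (hα1 : 1 < α) (p : ℕ) (hpα : α < p) :
    ∃ (S : Set Λ.R) (b : Λ.R) (h : Λ.R → Λ.R) (t : Λ.R → List Λ.R), S.Finite ∧ b ∈ S ∧
      h b = b ∧ t b ≠ [] ∧ ∀ a ∈ S, 0 < Λ.val a ∧ h a ∈ S ∧ (∀ c ∈ t a, c ∈ S) ∧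
        Λ.val (h a) + ((t a).map Λ.val).sum = α * Λ.val a ∧ p ∣ (t a).length ∧
        ∃ n, h^[n] a = b := by
  classical
  have hα0 : 0 < α := by linarith
  have hp' : (0 : ℝ) < p := hα0.trans hpα
  have hp : 0 < p := by exact_mod_cast hp'
  have hD := Λ.D_pos
  -- Since `N (T b - b) ≤ (ρ + 1) * N b` and `val (T b - b) = (α - 1) * val b`, these constants make
  -- `T b - b` splittable.
  obtain ⟨b, hb0, hb1, hb2⟩ := Λ.exists_deep_element hα1 (Λ.ρ + 1) (2 * p * Λ.D)
    (by linarith [Λ.ρ_nonneg])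
  have hgap : 0 < α - Λ.ρ := sub_pos.mpr Λ.ρ_lt
  have hpgap : 0 < p - α := sub_pos.mpr hpα
  -- The third condition makes `T a - b` deep enough to split once `α * val a > Y`; the last keeps
  -- the pieces below `Y`, and is where `α < p` is needed.
  obtain ⟨Y, hY1, hY2, hY3, hY4⟩ : ∃ Y : ℝ, Λ.val b ≤ Y ∧ α * Λ.val b + p * Λ.D ≤ p * Y ∧
      α * (Λ.N b + Λ.val b + 2 * p * Λ.D) ≤ (α - Λ.ρ) * Y ∧ p * Λ.D ≤ (p - α) * Y := by
    have hN := tendsto_id (α := ℝ) (x := atTop)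
    obtain ⟨Y, h⟩ := (((hN.eventually_ge_atTop (Λ.val b)).and
      ((hN.const_mul_atTop hp').eventually_ge_atTop (α * Λ.val b + p * Λ.D))).and
      (((hN.const_mul_atTop hgap).eventually_ge_atTop
        (α * (Λ.N b + Λ.val b + 2 * p * Λ.D))).and
      ((hN.const_mul_atTop hpgap).eventually_ge_atTop (p * Λ.D)))).exists
    exact ⟨Y, h.1.1, h.1.2, h.2.1, h.2.2⟩
  have hNsub : ∀ a, Λ.N (Λ.T a - b) ≤ Λ.ρ * Λ.N a + Λ.N b := fun a =>
    (Λ.N_sub_le _ _).trans (add_le_add_left (Λ.N_T_le a) _)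
  have hvsub : ∀ a, Λ.val (Λ.T a - b) = α * Λ.val a - Λ.val b := fun a => by
    rw [map_sub, Λ.val_T]
  have hsplit : ∀ a, a ∈ Λ.cone Y → ¬ (a ≠ b ∧ α * Λ.val a ≤ Y) →
      ∃ w : List Λ.R, w.length = p ∧ w.sum = Λ.T a - b ∧ ∀ g ∈ w, g ∈ Λ.cone Y := by
    rintro a ⟨ha0, haY, haN⟩ ha
    apply Λ.exists_split_in_cone p hp Y
    · rw [hvsub]
      by_cases hab : a = b
      · rw [hab] at *
        linarith [hNsub b]
      · have hlarge : Y < α * Λ.val a := by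
          by_contra hcon
          exact ha ⟨hab, not_lt.mp hcon⟩
        have h1 : (α - Λ.ρ) * Y ≤ (α - Λ.ρ) * (α * Λ.val a) :=
          mul_le_mul_of_nonneg_left hlarge.le hgap.le
        have h2 : Λ.N b + Λ.val b + 2 * p * Λ.D ≤ (α - Λ.ρ) * Λ.val a := by
          refine le_of_mul_le_mul_left ?_ hα0
          linarith
        have h3 := mul_le_mul_of_nonneg_left haN Λ.ρ_nonneg
        linarith [hNsub a]
    · rw [hvsub]
      have := mul_le_mul_of_nonneg_left haY hα0.le
      linarith
  choose! sp hsp1 hsp2 hsp3 using hsplit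
  refine ⟨Λ.cone Y, b, fun a => if a ≠ b ∧ α * Λ.val a ≤ Y then Λ.T a else b,
    fun a => if a ≠ b ∧ α * Λ.val a ≤ Y then [] else sp a, Λ.cone_finite Y,
    ⟨hb0, hY1, hb2⟩, by simp, ?_, ?_⟩
  · have h := hsp1 b ⟨hb0, hY1, hb2⟩ (by simp)
    simp only [ne_eq, not_true_eq_false, false_and, if_false]
    intro h0
    rw [h0] at h
    simp at h
    omega
  · intro a ha
    have hTcone : a ≠ b ∧ α * Λ.val a ≤ Y → Λ.T a ∈ Λ.cone Y := by
      intro hc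
      refine ⟨?_, ?_, ?_⟩
      · rw [Λ.val_T]; exact mul_pos hα0 ha.1
      · rw [Λ.val_T]; exact hc.2
      · rw [Λ.val_T]
        refine (Λ.N_T_le a).trans (mul_le_mul Λ.ρ_lt.le ha.2.2 (Λ.N_nonneg a) hα0.le)
    refine ⟨ha.1, ?_, ?_, ?_, ?_, ?_⟩
    · by_cases hc : a ≠ b ∧ α * Λ.val a ≤ Y
      · simp only [hc, ne_eq, not_false_eq_true, and_self, if_true]; exact hTcone hc
      · simp only [hc, if_false]; exact ⟨hb0, hY1, hb2⟩
    · by_cases hc : a ≠ b ∧ α * Λ.val a ≤ Y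
      · simp [hc]
      · simp only [hc, if_false]; exact hsp3 a ha hc
    · by_cases hc : a ≠ b ∧ α * Λ.val a ≤ Y
      · simp only [hc, ne_eq, not_false_eq_true, and_self, if_true]
        simp [Λ.val_T]
      · simp only [hc, if_false]
        rw [← map_list_sum, hsp2 a ha hc, hvsub]; ring
    · by_cases hc : a ≠ b ∧ α * Λ.val a ≤ Y
      · simp [hc]
      · simp only [hc, if_false]; rw [hsp1 a ha hc]
    -- If the chain of first letters never met `b`, it would multiply `val` by α at every step and
    -- eventually exceed `Y`.
    · by_contra! hne
      have hiter : ∀ n : ℕ, Λ.val ((fun a => if a ≠ b ∧ α * Λ.val a ≤ Y then Λ.T a else b)^[n] a)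
          = α ^ n * Λ.val a ∧ α ^ n * Λ.val a ≤ Y := by
        intro n
        induction n with
        | zero => simpa using ha.2.1
        | succ n ih =>
          have h1 := hne (n + 1)
          rw [Function.iterate_succ_apply'] at h1 ⊢
          set z := (fun a => if a ≠ b ∧ α * Λ.val a ≤ Y then Λ.T a else b)^[n] a
          by_cases hc : z ≠ b ∧ α * Λ.val z ≤ Y
          · have h2 : α ^ (n + 1) * Λ.val a = α * Λ.val z := by rw [ih.1]; ring
            rw [if_pos hc, Λ.val_T, h2]
            exact ⟨rfl, hc.2⟩
          · exact absurd (if_neg hc) h1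
      obtain ⟨n, hn⟩ := ((tendsto_pow_atTop_atTop_of_one_lt hα1).atTop_mul_const
        ha.1).eventually_gt_atTop Y |>.exists
      exact absurd (hiter n).2 (not_le.mpr hn)

end PerronLattice

/-! ### Iterates of a morphism on words -/

section Words

variable {B : Type*} (τ : B → List B)

theorem wordMap_append (u v : List B) : wordMap τ (u ++ v) = wordMap τ u ++ wordMap τ v := by
  simp [wordMap]

theorem wordMap_cons (a : B) (v : List B) : wordMap τ (a :: v) = τ a ++ wordMap τ v := by
  simp [wordMap]

theorem wordMap_nil : wordMap τ [] = [] := rfl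

theorem wordMap_singleton (a : B) : wordMap τ [a] = τ a := by simp [wordMap]

theorem wordMap_iterate_append (n : ℕ) (u v : List B) :
    (wordMap τ)^[n] (u ++ v) = (wordMap τ)^[n] u ++ (wordMap τ)^[n] v := by
  induction n generalizing u v with
  | zero => rfl
  | succ n ih => simp only [Function.iterate_succ_apply, wordMap_append, ih]

theorem wordMap_iterate_eq_flatMap (n : ℕ) (w : List B) :
    (wordMap τ)^[n] w = w.flatMap fun a => (wordMap τ)^[n] [a] := by
  induction w with
  | nil => exact Function.iterate_fixed (wordMap_nil τ) n
  | cons a w ih =>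
    rw [← List.singleton_append, wordMap_iterate_append, ih]
    simp

theorem wordMap_isPrefix {u v : List B} (h : u <+: v) : wordMap τ u <+: wordMap τ v := by
  obtain ⟨s, rfl⟩ := h
  rw [wordMap_append]
  exact List.prefix_append _ _

theorem mem_wordMap_iterate_trans {m n : ℕ} {a b c : B} (h₁ : b ∈ (wordMap τ)^[m] [a])
    (h₂ : c ∈ (wordMap τ)^[n] [b]) : c ∈ (wordMap τ)^[n + m] [a] := by
  rw [Function.iterate_add_apply, wordMap_iterate_eq_flatMap, List.mem_flatMap]
  exact ⟨b, h₁, h₂⟩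

theorem exists_mem_wordMap_iterate {a c : B}
    (h : Relation.ReflTransGen (fun a c => c ∈ τ a) a c) : ∃ n, c ∈ (wordMap τ)^[n] [a] := by
  induction h with
  | refl => exact ⟨0, by simp⟩
  | tail _ h ih =>
    obtain ⟨n, hn⟩ := ih
    exact ⟨1 + n, mem_wordMap_iterate_trans τ hn (by simpa [wordMap] using h)⟩

/-- If every letter leads to `b`, which occurs in its own image and leads to every letter, then
the iterated images of any letter contain all letters from some point on. -/
theorem exists_forall_mem_wordMap_iterate [Finite B] (b : B) (hb : b ∈ τ b)
    (hto : ∀ a, Relation.ReflTransGen (fun a c => c ∈ τ a) a b)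
    (hfrom : ∀ c, Relation.ReflTransGen (fun a c => c ∈ τ a) b c) :
    ∃ k, ∀ a c, c ∈ (wordMap τ)^[k] [a] := by
  cases nonempty_fintype B
  have hloop : ∀ n, b ∈ (wordMap τ)^[n] [b] := by
    intro n
    induction n with
    | zero => simp
    | succ n ih => exact mem_wordMap_iterate_trans τ (m := 1) (by simpa [wordMap] using hb) ih
  choose f hf using fun a => exists_mem_wordMap_iterate τ (hto a)
  choose g hg using fun c => exists_mem_wordMap_iterate τ (hfrom c)
  -- One exponent serves all pairs: go from `a` to `b`, use the loop at `b` to fill the unused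
  -- steps, then go to `c`.
  refine ⟨(∑ c, g c) + ∑ a, f a, fun a c => ?_⟩
  have h1 : f a ≤ ∑ a, f a := Finset.single_le_sum (fun _ _ => Nat.zero_le _) (Finset.mem_univ a)
  have h2 : g c ≤ ∑ c, g c := Finset.single_le_sum (fun _ _ => Nat.zero_le _) (Finset.mem_univ c)
  have h3 := mem_wordMap_iterate_trans τ (hf a) (hloop (∑ a, f a - f a))
  rw [Nat.sub_add_cancel h1] at h3
  have h4 := mem_wordMap_iterate_trans τ (hloop (∑ c, g c - g c)) (hg c)
  rw [Nat.add_sub_cancel' h2] at h4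
  exact mem_wordMap_iterate_trans τ h3 h4

end Words

/-! ### Positive weights: growth, dominant eigenvalue, primitivity -/

section Weights

variable {B : Type*} {τ : B → List B} {w : B → ℝ} {α : ℝ}

theorem sum_map_wordMap (hw : ∀ b, ((τ b).map w).sum = α * w b) (u : List B) :
    ((wordMap τ u).map w).sum = α * (u.map w).sum := by
  induction u with
  | nil => simp [wordMap]
  | cons a u ih => simp [wordMap_cons, hw, ih, mul_add]

theorem sum_map_wordMap_iterate (hw : ∀ b, ((τ b).map w).sum = α * w b) (n : ℕ) (u : List B) :
    (((wordMap τ)^[n] u).map w).sum = α ^ n * (u.map w).sum := by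
  induction n with
  | zero => simp
  | succ n ih => rw [Function.iterate_succ_apply', sum_map_wordMap hw, ih]; ring

/-- The weight of the `n`-th image is `α ^ n * w b`, and is at most its length times the total
weight of the alphabet. -/
theorem tendsto_length_wordMap_iterate [Finite B] (hα : 1 < α) (hpos : ∀ b, 0 < w b)
    (hw : ∀ b, ((τ b).map w).sum = α * w b) (b : B) :
    Tendsto (fun n : ℕ => ((wordMap τ)^[n] [b]).length) atTop atTop := by
  cases nonempty_fintype B
  have hC : ∀ u : List B, (u.map w).sum ≤ u.length * ∑ c, w c := by
    intro u
    induction u with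
    | nil => simp
    | cons a u ih =>
      have := Finset.single_le_sum (f := w) (fun c _ => (hpos c).le) (Finset.mem_univ a)
      simp only [List.map_cons, List.sum_cons, List.length_cons]
      push_cast
      linarith
  have hCpos : 0 < ∑ c, w c := Finset.sum_pos (fun c _ => hpos c) ⟨b, Finset.mem_univ b⟩
  rw [← tendsto_natCast_atTop_iff (R := ℝ)]
  refine tendsto_atTop_mono (fun n => ?_) ((tendsto_pow_atTop_atTop_of_one_lt hα).atTop_mul_const
    (div_pos (hpos b) hCpos))
  have h := hC ((wordMap τ)^[n] [b])
  rw [sum_map_wordMap_iterate hw] at h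
  rw [← mul_div_assoc, div_le_iff₀ hCpos]
  simpa using h

theorem List.sum_map_eq_sum_count {B M : Type*} [Fintype B] [DecidableEq B] [Semiring M]
    (f : B → M) (u : List B) : (u.map f).sum = ∑ i, f i * (u.count i : M) := by
  induction u with
  | nil => simp
  | cons a u ih =>
    simp only [List.map_cons, List.sum_cons, List.count_cons, ih]
    push_cast
    simp [mul_add, Finset.sum_add_distrib, add_comm]

/-- The left eigenvector `w` makes α an eigenvalue. If `M z = μ z`, then `|μ| |z| ≤ M |z|`
entrywise; pairing with `w > 0` gives `|μ| ≤ α`. No irreducibility enters, so this also covers the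
marked substitution. -/
theorem isDominantEigenvalue_of_weight [Fintype B] [Nonempty B] (τ : Substitution B)
    (hα : 0 < α) (hpos : ∀ b, 0 < w b) (hw : ∀ b, ((τ.toFun b).map w).sum = α * w b) :
    IsDominantEigenvalue (τ.incidenceMatrix ℂ) (α : ℂ) := by
  classical
  have hentry : ∀ j, ∑ i, w i * ((τ.toFun j).count i : ℝ) = α * w j := fun j => by
    rw [← hw j, List.sum_map_eq_sum_count]
  have hM : ∀ i j, τ.incidenceMatrix ℂ i j = (((τ.toFun j).count i : ℝ) : ℂ) := by
    intro i j
    simp only [Substitution.incidenceMatrix, Matrix.of_apply, Complex.ofReal_natCast]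
  constructor
  · have hdet : (τ.incidenceMatrix ℂ - (α : ℂ) • (1 : Matrix B B ℂ)).det = 0 := by
      rw [← Matrix.exists_vecMul_eq_zero_iff]
      refine ⟨fun b => (w b : ℂ), ?_, ?_⟩
      · intro h
        obtain ⟨b⟩ := ‹Nonempty B›
        have := congrFun h b
        simp only [Pi.zero_apply, Complex.ofReal_eq_zero] at this
        exact (hpos b).ne' this
      · rw [Matrix.vecMul_sub, Matrix.vecMul_smul, Matrix.vecMul_one]
        funext j
        simp only [Matrix.vecMul, dotProduct, hM, Pi.sub_apply, Pi.smul_apply, smul_eq_mul,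
          Pi.zero_apply]
        rw [sub_eq_zero]
        exact_mod_cast hentry j
    obtain ⟨v, hv0, hv⟩ := Matrix.exists_mulVec_eq_zero_iff.mpr hdet
    rw [Matrix.sub_mulVec, Matrix.smul_mulVec, Matrix.one_mulVec, sub_eq_zero] at hv
    exact Module.End.hasEigenvalue_of_hasEigenvector
      (Module.End.hasEigenvector_iff.mpr ⟨Module.End.mem_eigenspace_iff.mpr hv, hv0⟩)
  · intro μ hμ _
    obtain ⟨z, hz⟩ := hμ.exists_hasEigenvector
    have hz0 := hz.2
    have hzμ : Matrix.mulVec (τ.incidenceMatrix ℂ) z = μ • z := hz.apply_eq_smul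
    have hi : ∀ i, ‖μ‖ * ‖z i‖ ≤ ∑ j, ((τ.toFun j).count i : ℝ) * ‖z j‖ := by
      intro i
      have h := congrFun hzμ i
      rw [Pi.smul_apply, smul_eq_mul] at h
      rw [← norm_mul, ← h]
      refine (norm_sum_le _ _).trans_eq (Finset.sum_congr rfl fun j _ => ?_)
      beta_reduce
      rw [norm_mul, hM, Complex.norm_real, Real.norm_of_nonneg (Nat.cast_nonneg _)]
    have hsum : ‖μ‖ * ∑ i, w i * ‖z i‖ ≤ α * ∑ i, w i * ‖z i‖ := by
      calc ‖μ‖ * ∑ i, w i * ‖z i‖ = ∑ i, w i * (‖μ‖ * ‖z i‖) := by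
            rw [Finset.mul_sum]; exact Finset.sum_congr rfl fun i _ => by ring
        _ ≤ ∑ i, w i * ∑ j, ((τ.toFun j).count i : ℝ) * ‖z j‖ :=
            Finset.sum_le_sum fun i _ => mul_le_mul_of_nonneg_left (hi i) (hpos i).le
        _ = ∑ j, (∑ i, w i * ((τ.toFun j).count i : ℝ)) * ‖z j‖ := by
            simp only [Finset.mul_sum, Finset.sum_mul]
            rw [Finset.sum_comm]
            exact Finset.sum_congr rfl fun j _ => Finset.sum_congr rfl fun i _ => by ring
        _ = α * ∑ i, w i * ‖z i‖ := by
            rw [Finset.mul_sum]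
            exact Finset.sum_congr rfl fun j _ => by rw [hentry]; ring
    have hzpos : 0 < ∑ i, w i * ‖z i‖ := by
      obtain ⟨i, hi⟩ := Function.ne_iff.mp hz0
      exact Finset.sum_pos' (fun j _ => mul_nonneg (hpos j).le (norm_nonneg _))
        ⟨i, Finset.mem_univ i, mul_pos (hpos i) (norm_pos_iff.mpr hi)⟩
    rw [Complex.norm_real, Real.norm_of_nonneg hα.le]
    exact le_of_mul_le_mul_right hsum hzpos

theorem Substitution.isPrimitive_of_forall_mem [Fintype B] (τ : Substitution B) (k : ℕ)
    (hk : ∀ a c, c ∈ (wordMap τ.toFun)^[k] [a]) : τ.IsPrimitive := by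
  classical
  have hM : ∀ i j, τ.incidenceMatrix ℤ i j = ((τ.toFun j).count i : ℤ) := by
    intro i j
    simp only [Substitution.incidenceMatrix, Matrix.of_apply]
  have hnn : ∀ i j, 0 ≤ τ.incidenceMatrix ℤ i j := fun i j => by rw [hM]; positivity
  have hpow : ∀ n i j, i ∈ (wordMap τ.toFun)^[n] [j] → 0 < (τ.incidenceMatrix ℤ ^ n) i j := by
    intro n
    induction n with
    | zero => intro i j h; simp_all
    | succ n ih =>
      intro i j h
      rw [Function.iterate_succ_apply', wordMap, List.mem_flatMap] at h
      obtain ⟨l, hl, hil⟩ := h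
      rw [pow_succ', Matrix.mul_apply]
      refine Finset.sum_pos' (fun l _ => mul_nonneg (hnn i l) ?_)
        ⟨l, Finset.mem_univ l, mul_pos ?_ (ih l j hl)⟩
      · exact Matrix.pow_apply_nonneg hnn n l j
      · rw [hM]; exact_mod_cast List.count_pos_iff.mpr hil
  unfold Substitution.IsPrimitive
  have key : (∀ i j, 0 ≤ τ.incidenceMatrix ℤ i j) ∧
      ∃ k > 0, ∀ i j, 0 < (τ.incidenceMatrix ℤ ^ k) i j := by
    -- The exponent must be positive and `k` may be 0; images are non-empty, so one more step is
    -- harmless.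
    refine ⟨hnn, k + 1, Nat.succ_pos k, fun i j => hpow _ i j ?_⟩
    obtain ⟨a, ha⟩ := List.exists_mem_of_ne_nil _ (τ.toFun_ne_nil j)
    exact mem_wordMap_iterate_trans τ.toFun (m := 1) (by simpa [wordMap] using ha) (hk a i)
  refine ⟨key.1, ?_⟩
  convert key.2

end Weights

/-! ### Fixed points through their prefixes -/

section FixedPoints

variable {B : Type*}

theorem length_seqPrefix (y : ℕ → B) (n : ℕ) : (seqPrefix y n).length = n := by
  simp [seqPrefix]

theorem getElem_seqPrefix (y : ℕ → B) (n k : ℕ) (h : k < (seqPrefix y n).length) :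
    (seqPrefix y n)[k] = y k := by
  simp [seqPrefix]

theorem seqPrefix_succ (y : ℕ → B) (n : ℕ) : seqPrefix y (n + 1) = seqPrefix y n ++ [y n] := by
  rw [seqPrefix, List.ofFn_succ_last]
  simp [seqPrefix]

theorem seqPrefix_isPrefix (y : ℕ → B) {m n : ℕ} (h : m ≤ n) :
    seqPrefix y m <+: seqPrefix y n := by
  induction n, h using Nat.le_induction with
  | base => exact List.prefix_rfl
  | succ n _ ih => rw [seqPrefix_succ]; exact ih.trans (List.prefix_append _ _)

theorem seqMap_eq_getElem {C : Type*} (τ : B → List C) (hτ : ∀ a, τ a ≠ []) (y : ℕ → B) (k : ℕ)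
    (h : k < (wordMap τ (seqPrefix y (k + 1))).length) :
    seqMap τ hτ y k = (wordMap τ (seqPrefix y (k + 1)))[k] := rfl

theorem lt_length_wordMap_seqPrefix (τ : Substitution B) (y : ℕ → B) (n : ℕ) :
    n ≤ (wordMap τ.toFun (seqPrefix y n)).length := by
  have h := length_wordMap_ge τ.toFun τ.toFun_ne_nil (seqPrefix y n)
  rwa [length_seqPrefix] at h

theorem Substitution.isFixedPoint_iff (τ : Substitution B) (y : ℕ → B) :
    τ.IsFixedPoint y ↔ ∀ n, wordMap τ.toFun (seqPrefix y n) =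
      seqPrefix y (wordMap τ.toFun (seqPrefix y n)).length := by
  constructor
  · intro h n
    refine List.ext_getElem (by rw [length_seqPrefix]) fun k h1 h2 => ?_
    have hk := lt_length_wordMap_seqPrefix τ y (k + 1)
    have h3 : y k = (wordMap τ.toFun (seqPrefix y (k + 1)))[k] := (congrFun h k).symm
    rw [getElem_seqPrefix, h3]
    rcases le_total n (k + 1) with hn | hn
    · exact (wordMap_isPrefix τ.toFun (seqPrefix_isPrefix y hn)).getElem h1
    · exact ((wordMap_isPrefix τ.toFun (seqPrefix_isPrefix y hn)).getElem hk).symm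
  · intro h
    funext k
    have hk := lt_length_wordMap_seqPrefix τ y (k + 1)
    rw [seqMap_eq_getElem _ _ _ _ hk, List.getElem_of_eq (h (k + 1)) hk, getElem_seqPrefix]

/-- The `k`-th image of the prefix of length `m` is a prefix of `y` of length at least `m`; the
block following it is the image of `y m`, which contains `b`. -/
theorem Substitution.IsFixedPoint.exists_ge {τ : Substitution B} {y : ℕ → B}
    (hy : τ.IsFixedPoint y) {k : ℕ} {b : B} (hb : ∀ a, b ∈ (wordMap τ.toFun)^[k] [a]) (m : ℕ) :
    ∃ n, m ≤ n ∧ y n = b := by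
  rw [τ.isFixedPoint_iff] at hy
  have hiter : ∀ k n, (wordMap τ.toFun)^[k] (seqPrefix y n) =
      seqPrefix y ((wordMap τ.toFun)^[k] (seqPrefix y n)).length ∧
      n ≤ ((wordMap τ.toFun)^[k] (seqPrefix y n)).length := by
    intro k n
    induction k with
    | zero => simp [length_seqPrefix]
    | succ k ih =>
      rw [Function.iterate_succ_apply']
      set L := ((wordMap τ.toFun)^[k] (seqPrefix y n)).length
      rw [ih.1]
      exact ⟨hy L, ih.2.trans (lt_length_wordMap_seqPrefix τ y L)⟩
  obtain ⟨h1, h2⟩ := hiter k (m + 1)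
  have hm := (hiter k m).2
  rw [seqPrefix_succ, wordMap_iterate_append] at h1
  obtain ⟨i, hi, hib⟩ := List.mem_iff_getElem.mp (hb (y m))
  refine ⟨((wordMap τ.toFun)^[k] (seqPrefix y m)).length + i, by omega, ?_⟩
  have hlt : ((wordMap τ.toFun)^[k] (seqPrefix y m)).length + i <
      ((wordMap τ.toFun)^[k] (seqPrefix y m) ++ (wordMap τ.toFun)^[k] [y m]).length := by
    rw [List.length_append]; omega
  have h3 := List.getElem_of_eq h1 hlt
  rw [getElem_seqPrefix] at h3
  rw [← h3, List.getElem_append_right (by omega)]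
  simpa using hib

/-- As `τ(b) = bt`, each iterate on `b` extends the previous one by a non-empty word, so the
iterates converge to an infinite sequence. -/
theorem Substitution.exists_fixedPoint (τ : Substitution B) (b : B) (t : List B)
    (hb : τ.toFun b = b :: t) (ht : t ≠ []) :
    ∃ y : ℕ → B, τ.IsFixedPoint y ∧ ∀ n k (h : k < ((wordMap τ.toFun)^[n] [b]).length),
      ((wordMap τ.toFun)^[n] [b])[k] = y k := by
  set W : ℕ → List B := fun n => (wordMap τ.toFun)^[n] [b] with hW
  have hne : ∀ n, (wordMap τ.toFun)^[n] t ≠ [] := by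
    intro n
    induction n with
    | zero => exact ht
    | succ n ih =>
      rw [Function.iterate_succ_apply']
      have := length_wordMap_ge τ.toFun τ.toFun_ne_nil ((wordMap τ.toFun)^[n] t)
      have h2 := List.length_pos_iff.mpr ih
      exact List.length_pos_iff.mp (by omega)
  have hsucc : ∀ n, W (n + 1) = W n ++ (wordMap τ.toFun)^[n] t := by
    intro n
    simp only [hW]
    rw [Function.iterate_succ_apply, wordMap_singleton, hb, ← List.singleton_append,
      wordMap_iterate_append]
  have hmono : ∀ {m n}, m ≤ n → W m <+: W n := by
    intro m n h
    induction n, h using Nat.le_induction with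
    | base => exact List.prefix_rfl
    | succ n _ ih => rw [hsucc]; exact ih.trans (List.prefix_append _ _)
  have hlen : ∀ n, n < (W n).length := by
    intro n
    induction n with
    | zero => simp [hW]
    | succ n ih =>
      have := List.length_pos_iff.mpr (hne n)
      rw [hsucc, List.length_append]; omega
  have hy : ∀ n k (h : k < (W n).length), (W n)[k] = (W k)[k]'(hlen k) := by
    intro n k h
    rcases le_total n k with hnk | hnk
    · exact (hmono hnk).getElem h
    · exact ((hmono hnk).getElem (hlen k)).symm
  refine ⟨fun k => (W k)[k]'(hlen k), ?_, hy⟩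
  funext k
  have hk := lt_length_wordMap_seqPrefix τ (fun k => (W k)[k]'(hlen k)) (k + 1)
  rw [seqMap_eq_getElem _ _ _ _ hk, ← hy (k + 1 + 1) k (by have := hlen (k + 1 + 1); omega)]
  have hpre : seqPrefix (fun k => (W k)[k]'(hlen k)) (k + 1) <+: W (k + 1) := by
    rw [List.prefix_iff_eq_take, length_seqPrefix]
    refine List.ext_getElem ?_ fun i h1 h2 => ?_
    · have := hlen (k + 1)
      rw [length_seqPrefix, List.length_take]; omega
    · rw [getElem_seqPrefix, List.getElem_take]
      exact (hy (k + 1) i (by rw [List.length_take] at h2; omega)).symm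
  have h2 : wordMap τ.toFun (W (k + 1)) = W (k + 1 + 1) := by
    simp only [hW]; rw [Function.iterate_succ_apply' _ (k + 1)]
  have h3 := wordMap_isPrefix τ.toFun hpre
  rw [h2] at h3
  exact h3.getElem hk

end FixedPoints

/-! ### Labels modulo `p` -/

section Rotation

variable {B : Type*} {p : ℕ}

/-- The labels of the letters of a word are `i, i + 1, i + 2, …` modulo `p`. -/
def IsRotation (lab : B → ZMod p) : ZMod p → List B → Prop
  | _, [] => True
  | i, b :: u => lab b = i ∧ IsRotation lab (i + 1) u

theorem isRotation_append (lab : B → ZMod p) (i : ZMod p) (u v : List B) :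
    IsRotation lab i (u ++ v) ↔ IsRotation lab i u ∧ IsRotation lab (i + u.length) v := by
  induction u generalizing i with
  | nil => simp [IsRotation]
  | cons a u ih =>
    simp only [List.cons_append, IsRotation, ih, List.length_cons]
    push_cast
    rw [and_assoc, add_assoc, add_comm (1 : ZMod p)]

theorem IsRotation.lab_getElem {lab : B → ZMod p} {i : ZMod p} {u : List B}
    (h : IsRotation lab i u) (k : ℕ) (hk : k < u.length) : lab u[k] = i + k := by
  induction u generalizing i k with
  | nil => simp at hk
  | cons a u ih =>
    cases k with
    | zero => simpa using h.1
    | succ k =>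
      rw [List.getElem_cons_succ, ih h.2]
      push_cast
      ring

/-- An image of length 1 modulo `p` advances the label by exactly 1, which is the label where the
image of the next letter starts. -/
theorem IsRotation.wordMap {lab : B → ZMod p} {τ : B → List B}
    (hτ : ∀ b, IsRotation lab (lab b) (τ b)) (hlen : ∀ b, ((τ b).length : ZMod p) = 1)
    {i : ZMod p} {u : List B} (h : IsRotation lab i u) : IsRotation lab i (wordMap τ u) := by
  induction u generalizing i with
  | nil => exact trivial
  | cons a u ih =>
    rw [wordMap_cons, isRotation_append, hlen]
    exact ⟨h.1 ▸ hτ a, ih h.2⟩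

/-- Attach the labels `i, i + 1, i + 2, …` to the letters of a word. -/
def rotate : ZMod p → List B → List (B × ZMod p)
  | _, [] => []
  | i, b :: u => (b, i) :: rotate (i + 1) u

theorem map_fst_rotate (i : ZMod p) (u : List B) : (rotate i u).map Prod.fst = u := by
  induction u generalizing i with
  | nil => rfl
  | cons a u ih => simp [rotate, ih]

theorem isRotation_map_subtype {lab : B → ZMod p} {P : B → Prop} (i : ZMod p)
    (u : List (Subtype P)) :
    IsRotation (fun x : Subtype P => lab x) i u ↔ IsRotation lab i (u.map Subtype.val) := by
  induction u generalizing i with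
  | nil => rfl
  | cons a u ih => simp [IsRotation, ih]

theorem isRotation_rotate (i : ZMod p) (u : List B) : IsRotation Prod.snd i (rotate i u) := by
  induction u generalizing i with
  | nil => trivial
  | cons a u ih => exact ⟨rfl, ih _⟩

end Rotation

/-! ### The labelled substitution -/

/-- A substitution with a positive weight multiplied by `α` and a labelled fixed point whose
labels are `0, 1, 2, …` modulo `p`. -/
theorem exists_labelled_substitution {α : ℝ} (hα : IsPerronNumber α) (hα1 : 1 < α) (p : ℕ)
    (hp : α < p) :
    ∃ (B : Type) (_ : Fintype B) (τ : Substitution B) (y : ℕ → B) (w : B → ℝ) (lab : B → ZMod p),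
      (∀ b, 0 < w b) ∧ (∀ b, ((τ.toFun b).map w).sum = α * w b) ∧
      (∃ k, ∀ a c, c ∈ (wordMap τ.toFun)^[k] [a]) ∧ τ.IsFixedPoint y ∧
      ∀ n : ℕ, lab (y n) = n := by
  classical
  obtain ⟨Λ⟩ := exists_perronLattice α hα hα1
  obtain ⟨S, b, h, t, hS, hbS, hhb, htb, hmain⟩ := Λ.exists_decomposition hα1 p hp
  have : NeZero p := ⟨by rintro rfl; rw [Nat.cast_zero] at hp; linarith⟩
  let τ₀ : Λ.R × ZMod p → List (Λ.R × ZMod p) := fun x => rotate x.2 (h x.1 :: t x.1)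
  let r : Λ.R × ZMod p → Λ.R × ZMod p → Prop := fun x c => c ∈ τ₀ x
  -- Keeping only the letters reachable from `(b, 0)` gives half of primitivity for free; the other
  -- half is the return to `(b, 0)`.
  let C : Λ.R × ZMod p → Prop := Relation.ReflTransGen r (b, 0)
  have hstepS : ∀ x c, x.1 ∈ S → r x c → c.1 ∈ S := by
    intro x c hx hc
    have h1 : c.1 ∈ (τ₀ x).map Prod.fst := List.mem_map_of_mem hc
    rw [map_fst_rotate] at h1
    rcases List.mem_cons.mp h1 with h2 | h2
    · rw [h2]; exact (hmain _ hx).2.1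
    · exact (hmain _ hx).2.2.1 _ h2
  have hCS : ∀ x, C x → x.1 ∈ S := by
    intro x hx
    induction hx with
    | refl => exact hbS
    | tail _ hc ih => exact hstepS _ _ ih hc
  have hCfin : {x | C x}.Finite :=
    (hS.prod (Set.finite_univ (α := ZMod p))).subset fun x hx => ⟨hCS x hx, trivial⟩
  have : Finite (Subtype C) := hCfin
  let hfin : Fintype (Subtype C) := Fintype.ofFinite _
  let τ₁ : Subtype C → List (Subtype C) := fun x =>
    (τ₀ x).attachWith C fun _ hc => x.2.tail hc
  have hτ₁ : ∀ x, (τ₁ x).map Subtype.val = τ₀ x := fun x => List.attachWith_map_subtype_val _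
  have hmem : ∀ x c, c ∈ τ₁ x ↔ r x c := by
    intro x c
    change _ ↔ (c : Λ.R × ZMod p) ∈ τ₀ x
    rw [← hτ₁, List.mem_map]
    exact ⟨fun hc => ⟨c, hc, rfl⟩, fun ⟨d, hd, hdc⟩ => Subtype.ext hdc ▸ hd⟩
  let w : Subtype C → ℝ := fun x => Λ.val x.1.1
  have hwpos : ∀ x, 0 < w x := fun x => (hmain _ (hCS _ x.2)).1
  have hw : ∀ x, ((τ₁ x).map w).sum = α * w x := by
    intro x
    have h1 : (τ₁ x).map w = ((τ₀ x).map Prod.fst).map Λ.val := by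
      rw [← hτ₁, List.map_map, List.map_map]; rfl
    rw [h1, map_fst_rotate, List.map_cons, List.sum_cons]
    exact (hmain _ (hCS _ x.2)).2.2.2.1
  let lab : Subtype C → ZMod p := fun x => x.1.2
  have hrot : ∀ x, IsRotation lab (lab x) (τ₁ x) := by
    intro x
    rw [isRotation_map_subtype (lab := Prod.snd), hτ₁]
    exact isRotation_rotate _ _
  have hlen : ∀ x, ((τ₁ x).length : ZMod p) = 1 := by
    intro x
    have h1 : (τ₁ x).length = (t x.1.1).length + 1 := by
      rw [← List.length_map (f := Subtype.val), hτ₁, ← List.length_map (f := Prod.fst),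
        map_fst_rotate, List.length_cons]
    have h2 := (ZMod.natCast_eq_zero_iff _ _).mpr (hmain _ (hCS _ x.2)).2.2.2.2.1
    rw [h1, Nat.cast_add, h2, Nat.cast_one, zero_add]
  let τ : Substitution (Subtype C) := ⟨τ₁, tendsto_length_wordMap_iterate hα1 hwpos hw⟩
  let b' : Subtype C := ⟨(b, 0), .refl⟩
  obtain ⟨t', ht', hτb⟩ : ∃ t', t' ≠ [] ∧ τ₁ b' = b' :: t' := by
    have h1 : (τ₁ b').map Subtype.val = (b, 0) :: rotate (0 + 1) (t b) := by
      rw [hτ₁]; simp only [τ₀, b', rotate, hhb]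
    obtain ⟨c, t', h2, h3, h4⟩ := List.map_eq_cons_iff.mp h1
    refine ⟨t', ?_, by rw [h2]; congr 1; exact Subtype.ext h3⟩
    rintro rfl
    have h5 := map_fst_rotate (0 + 1 : ZMod p) (t b)
    rw [← h4] at h5
    exact htb h5.symm
  obtain ⟨y, hy, hyW⟩ := τ.exists_fixedPoint b' t' hτb ht'
  have hlift : ∀ (x : Subtype C) (c : Λ.R × ZMod p), Relation.ReflTransGen r x c →
      ∃ hc : C c, Relation.ReflTransGen (fun a c => c ∈ τ₁ a) x ⟨c, hc⟩ := by
    intro x c hxc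
    induction hxc with
    | refl => exact ⟨x.2, .refl⟩
    | tail _ hc ih =>
      obtain ⟨h1, h2⟩ := ih
      exact ⟨h1.tail hc, h2.tail ((hmem _ _).mpr hc)⟩
  have hhead : ∀ n a i, h^[n] a = b → Relation.ReflTransGen r (a, i) (b, i) := by
    intro n
    induction n with
    | zero => rintro a i rfl; exact .refl
    | succ n ih =>
      intro a i ha
      exact .head (List.mem_cons_self : (h a, i) ∈ (h a, i) :: _) (ih (h a) i ha)
  -- The second letter of the image of `(b, i)` has label `i + 1`, and following first letters from
  -- it leads to `b` without changing the label.
  have hnext : ∀ i, Relation.ReflTransGen r (b, i) (b, i + 1) := by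
    intro i
    obtain ⟨c, u, hcu⟩ := List.exists_cons_of_ne_nil htb
    obtain ⟨n, hn⟩ := (hmain c ((hmain b hbS).2.2.1 c (by simp [hcu]))).2.2.2.2.2
    refine .head (?_ : r (b, i) (c, i + 1)) (hhead n c (i + 1) hn)
    simp only [r, τ₀, hcu, rotate]
    simp
  have hshift : ∀ (k : ℕ) i, Relation.ReflTransGen r (b, i) (b, i + k) := by
    intro k i
    induction k with
    | zero => simpa using Relation.ReflTransGen.refl
    | succ k ih =>
      refine ih.trans ?_
      have := hnext (i + k)
      rwa [add_assoc, ← Nat.cast_succ] at this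
  have hto : ∀ x : Subtype C, Relation.ReflTransGen (fun a c => c ∈ τ₁ a) x b' := by
    rintro ⟨⟨a, i⟩, hx⟩
    obtain ⟨n, hn⟩ := (hmain a (hCS _ hx)).2.2.2.2.2
    have h1 := (hhead n a i hn).trans (hshift (-i).val i)
    rw [ZMod.natCast_zmod_val, add_neg_cancel] at h1
    exact (hlift ⟨(a, i), hx⟩ _ h1).2
  have hfrom : ∀ x : Subtype C, Relation.ReflTransGen (fun a c => c ∈ τ₁ a) b' x :=
    fun x => (hlift b' x x.2).2
  refine ⟨Subtype C, hfin, τ, y, w, lab, hwpos, hw,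
    exists_forall_mem_wordMap_iterate τ₁ b' (by simp [hτb]) hto hfrom, hy, fun n => ?_⟩
  have hWrot : ∀ n, IsRotation lab 0 ((wordMap τ₁)^[n] [b']) := by
    intro n
    induction n with
    | zero => exact ⟨rfl, trivial⟩
    | succ n ih => rw [Function.iterate_succ_apply']; exact ih.wordMap hrot hlen
  obtain ⟨m, hm⟩ := ((τ.growing b').eventually_gt_atTop n).exists
  rw [← hyW m n hm, (hWrot m).lab_getElem n hm, zero_add]

/-! ### Marking a prefix of the fixed point -/

section Extension

variable {B : Type*}

/-- The sequence `y` with its first `m` letters replaced by new, pairwise distinct ones. -/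
def markPrefix (m : ℕ) (y : ℕ → B) (n : ℕ) : Fin m ⊕ B :=
  if h : n < m then .inl ⟨n, h⟩ else .inr (y n)

/-- The projection forgetting the marking. -/
def unmark (m : ℕ) (y : ℕ → B) : Fin m ⊕ B → B := Sum.elim (fun i => y i) id

theorem unmark_markPrefix (m : ℕ) (y : ℕ → B) (n : ℕ) : unmark m y (markPrefix m y n) = y n := by
  unfold markPrefix unmark
  split <;> rfl

/-- The extension of a morphism fixing `y` to a morphism fixing `markPrefix m y`. -/
def markedMorphism (τ : B → List B) (m : ℕ) (y : ℕ → B) : Fin m ⊕ B → List (Fin m ⊕ B)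
  | .inl i => List.ofFn fun k : Fin (τ (y i)).length =>
      markPrefix m y ((wordMap τ (seqPrefix y i)).length + k)
  | .inr b => (τ b).map .inr

theorem Substitution.IsFixedPoint.apply_add {τ : Substitution B} {y : ℕ → B}
    (hy : τ.IsFixedPoint y) (n k : ℕ) (hk : k < (τ.toFun (y n)).length) :
    y ((wordMap τ.toFun (seqPrefix y n)).length + k) = (τ.toFun (y n))[k] := by
  have h := (τ.isFixedPoint_iff y).mp hy (n + 1)
  rw [seqPrefix_succ, wordMap_append, wordMap_singleton] at h
  have h1 := List.getElem_of_eq h (i := (wordMap τ.toFun (seqPrefix y n)).length + k)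
    (by rw [List.length_append]; omega)
  rw [getElem_seqPrefix, List.getElem_append_right (by omega)] at h1
  rw [← h1]
  simp

/-- Forgetting marks intertwines the two morphisms, so lengths of iterates and weights are inherited
from `τ`. -/
theorem map_unmark_markedMorphism {τ : Substitution B} {y : ℕ → B} (hy : τ.IsFixedPoint y)
    (m : ℕ) (c : Fin m ⊕ B) :
    (markedMorphism τ.toFun m y c).map (unmark m y) = τ.toFun (unmark m y c) := by
  cases c with
  | inl i =>
    refine List.ext_getElem (by simp [markedMorphism, unmark]) fun k h1 h2 => ?_
    simp only [markedMorphism, List.getElem_map, List.getElem_ofFn, unmark_markPrefix]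
    exact hy.apply_add i k h2
  | inr b => simp [markedMorphism, unmark, Function.comp_def]

theorem map_unmark_iterate {τ : Substitution B} {y : ℕ → B} (hy : τ.IsFixedPoint y)
    (m n : ℕ) (u : List (Fin m ⊕ B)) :
    ((wordMap (markedMorphism τ.toFun m y))^[n] u).map (unmark m y) =
      (wordMap τ.toFun)^[n] (u.map (unmark m y)) := by
  have hstep : ∀ u, (wordMap (markedMorphism τ.toFun m y) u).map (unmark m y) =
      wordMap τ.toFun (u.map (unmark m y)) := by
    intro u
    induction u with
    | nil => rfl
    | cons a u ih =>
      rw [wordMap_cons, List.map_append, ih, map_unmark_markedMorphism hy, List.map_cons,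
        wordMap_cons]
  induction n with
  | zero => rfl
  | succ n ih => rw [Function.iterate_succ_apply', hstep, ih, Function.iterate_succ_apply']

/-- The substitution fixing `markPrefix m y`. -/
def Substitution.marked (τ : Substitution B) {y : ℕ → B} (hy : τ.IsFixedPoint y) (m : ℕ) :
    Substitution (Fin m ⊕ B) where
  toFun := markedMorphism τ.toFun m y
  growing c := by
    refine (τ.growing (unmark m y c)).congr fun n => ?_
    rw [← List.length_map (f := unmark m y) (as := (wordMap _)^[n] [c]), map_unmark_iterate hy]
    rfl

theorem Substitution.marked_isFixedPoint (τ : Substitution B) {y : ℕ → B}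
    (hy : τ.IsFixedPoint y) (m : ℕ) : (τ.marked hy m).IsFixedPoint (markPrefix m y) := by
  have hlen : ∀ n, (wordMap (markedMorphism τ.toFun m y) (seqPrefix (markPrefix m y) n)).length =
      (wordMap τ.toFun (seqPrefix y n)).length := by
    intro n
    have h := map_unmark_iterate hy m 1 (seqPrefix (markPrefix m y) n)
    have h2 : (seqPrefix (markPrefix m y) n).map (unmark m y) = seqPrefix y n := by
      refine List.ext_getElem (by simp [length_seqPrefix]) fun k h1 h2 => ?_
      rw [List.getElem_map, getElem_seqPrefix, getElem_seqPrefix, unmark_markPrefix]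
    rw [h2] at h
    have h3 := congrArg List.length h
    rwa [List.length_map] at h3
  rw [Substitution.isFixedPoint_iff]
  intro n
  change wordMap (markedMorphism τ.toFun m y) _ =
    seqPrefix _ (wordMap (markedMorphism τ.toFun m y) _).length
  rw [hlen]
  induction n with
  | zero => rfl
  | succ n ih =>
    set L := (wordMap τ.toFun (seqPrefix y n)).length with hL
    have hsucc : (wordMap τ.toFun (seqPrefix y (n + 1))).length =
        L + (τ.toFun (y n)).length := by
      rw [seqPrefix_succ, wordMap_append, wordMap_singleton, List.length_append]
    have himg : markedMorphism τ.toFun m y (markPrefix m y n) =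
        List.ofFn fun k : Fin (τ.toFun (y n)).length => markPrefix m y (L + k) := by
      by_cases hn : n < m
      · have : markPrefix m y n = .inl ⟨n, hn⟩ := dif_pos hn
        rw [this]; rfl
      · have h0 : markPrefix m y n = .inr (y n) := dif_neg hn
        rw [h0]
        refine List.ext_getElem (by simp [markedMorphism]) fun k h1 h2 => ?_
        -- The image of an unmarked position `n ≥ m` starts at `L ≥ n`, hence meets no marked
        -- position.
        have hLn : n ≤ L := lt_length_wordMap_seqPrefix τ y n
        have h3 : markPrefix m y (L + k) = .inr (y (L + k)) := dif_neg (by omega)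
        simp only [markedMorphism, List.getElem_map, List.getElem_ofFn, h3]
        rw [hy.apply_add n k (by simpa [markedMorphism] using h1)]
    rw [hsucc, seqPrefix_succ, wordMap_append, wordMap_singleton, ih, himg]
    refine List.ext_getElem (by simp [length_seqPrefix]) fun k h1 h2 => ?_
    rw [getElem_seqPrefix]
    by_cases hk : k < L
    · rw [List.getElem_append_left (by rwa [length_seqPrefix]), getElem_seqPrefix]
    · rw [List.getElem_append_right (by rw [length_seqPrefix]; omega)]
      simp only [length_seqPrefix, List.getElem_ofFn]
      congr 1
      omega

end Extension

/-- A period of a sequence, taken large, yields a coding of a labelled fixed point. -/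
theorem exists_label_coding {A : Type*} {x : ℕ → A} (v : List A) (hv : v ≠ []) (m : ℕ)
    (hx : ∀ n, m ≤ n → x n = omegaPow v hv (n - m)) (α : ℝ) :
    ∃ (p : ℕ) (ψ : ZMod p → A), α < p ∧ ∀ n : ℕ, m ≤ n → x n = ψ n := by
  obtain ⟨N, hN⟩ := exists_nat_gt α
  have hl := List.length_pos_iff.mpr hv
  -- A multiple of the period exceeding α; labels count from position 0, hence the shift by `m`.
  refine ⟨v.length * (N + 1), fun i => omegaPow v hv
    (i - (m : ZMod (v.length * (N + 1)))).val, ?_, fun n hn => ?_⟩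
  · have h1 : N ≤ v.length * (N + 1) := by nlinarith
    exact hN.trans_le (by exact_mod_cast h1)
  · rw [hx n hn]
    beta_reduce
    rw [← Nat.cast_sub hn, ZMod.val_natCast]
    simp only [omegaPow, Nat.mod_mul_right_mod]

theorem mainTheorem5 {A : Type*} [Finite A] (x : ℕ → A) (α : ℝ)
    (hα : IsPerronNumber α) (hα1 : 1 < α) :
    (IsPeriodicSeq x → IsSubstitutivePrimitive α x) ∧
      (IsUltimatelyPeriodicSeq x → IsSubstitutive α x) := by
  constructor
  · rintro ⟨v, hv, rfl⟩
    obtain ⟨p, ψ, hp, hψ⟩ := exists_label_coding (x := omegaPow v hv) v hv 0 (fun _ _ => rfl) α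
    obtain ⟨B, hB, τ, y, w, lab, hpos, hw, ⟨k, hk⟩, hy, hlab⟩ :=
      exists_labelled_substitution hα hα1 p hp
    have : Nonempty B := ⟨y 0⟩
    refine ⟨B, hB, τ, y, fun b => ψ (lab b), τ.isPrimitive_of_forall_mem k hk, ⟨hy, fun b => ?_⟩,
      isDominantEigenvalue_of_weight τ (by linarith) hpos hw, ?_⟩
    · obtain ⟨n, _, hn⟩ := hy.exists_ge (fun a => hk a b) 0
      exact ⟨n, hn⟩
    · funext n
      beta_reduce
      rw [hlab, hψ n n.zero_le]
  · rintro ⟨u, v, hv, hx⟩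
    obtain ⟨p, ψ, hp, hψ⟩ := exists_label_coding (x := x) v hv u.length
      (fun n hn => by rw [hx]; exact dif_neg (not_lt.mpr hn)) α
    obtain ⟨B, hB, τ, y, w, lab, hpos, hw, ⟨k, hk⟩, hy, hlab⟩ :=
      exists_labelled_substitution hα hα1 p hp
    have : Nonempty B := ⟨y 0⟩
    refine ⟨Fin u.length ⊕ B, inferInstance, τ.marked hy u.length, markPrefix u.length y,
      Sum.elim (fun i => x i) (fun b => ψ (lab b)), trivial,
      ⟨τ.marked_isFixedPoint hy _, ?_⟩,
      isDominantEigenvalue_of_weight (w := fun c => w (unmark u.length y c)) _ (by linarith)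
        (fun c => hpos _) (fun c => ?_), ?_⟩
    · rintro (i | b)
      · exact ⟨i, dif_pos i.2⟩
      -- An occurrence of `b` beyond the marked prefix is needed, since earlier ones have been
      -- replaced by new letters.
      · obtain ⟨n, hn, hnb⟩ := hy.exists_ge (fun a => hk a b) u.length
        exact ⟨n, (dif_neg (not_lt.mpr hn)).trans (congrArg _ hnb)⟩
    · rw [← hw, ← map_unmark_markedMorphism hy, List.map_map]
      rfl
    · funext n
      by_cases hn : n < u.length
      · simp [markPrefix, hn]
      · simp only [markPrefix, hn, dite_false, Sum.elim_inr]
        rw [hlab, hψ n (not_lt.mp hn)]
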